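/- Let $G=(V,E)$ be a finite directed graph (loops allowed) with $m=|E|$ edges. A subgraph $H=(V,F)$, $F\subseteq E$, is eulerian if every vertex has equal in-degree and out-degree in $H$ (connectedness is not required), and a maximal eulerian subgraph of $G$ if it is not properly contained in another eulerian subgraph of $G$. For a rank function $r:V\to\mathbb Z$ and an edge $(u,v)$ put $$a((u,v),r)=\max(r(u)-r(v)+1,0),\qquad \mathrm{slack}((u,v),r)=\max(r(v)-r(u)-1,0),$$ and let $a(G,r)=\sum_{e\in E}a(e,r)$ be the agony of $G$. The rank $r$ conforms to $H$ if every $(u,v)\in E$ with $r(u)\ge r(v)$ is an edge of $H$. Algorithm $\mathrm{MinAgony}(G,H,r)$: while $a(G,r)>|E(H)|$, choose an edge $(p,s)\in E(H)$ of largest slack and replace $(H,r)$ by $\mathrm{Relief}(H,r,G,p,s)$; finally return $(H,r)$. Algorithm $\mathrm{Relief}(H,r,G,p,s)$: put $F=E(H)$, $r'=r$, $t(v)=0$ for all $v$, then $t(p)=r(s)-r(p)-1$, and put $p$ into a priority queue $S$ with priority $t(p)$. While $S\neq\emptyset$: remove from $S$ a vertex $u$ of highest priority and increase $r'(u)$ by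 $t(u)$; for every edge $e=(u,v)\in E\setminus F$ with $r'(v)\le r'(u)$ and $d:=r'(u)+1-r'(v)>t(v)$, set $t(v)=d$, insert $v$ into $S$ (or update it) with priority $d$, and record $u$ as the parent of $v$ via $e$; then for every edge $e=(w,u)\in F$ with $d:=\mathrm{slack}(e,r')-\mathrm{slack}(e,r)>0$ and $d>t(w)$, set $t(w)=d$, insert $w$ into $S$ (or update it) with priority $d$, and record $u$ as the parent of $w$ via $e$. When $S$ is empty: if $\mathrm{slack}((p,s),r')>0$, let $O$ be the set of edges recorded along the path of parents from $s$ to $p$, replace $F$ by the symmetric difference of $F$ and $O$, and delete $(p,s)$ from $F$. Return $((V,F),r')$. The queue is an array of linked lists indexed by the priorities; its creation and the search for the next non-empty list are paid for list by list. Time is the number of elementary steps, each of which treats one edge in a loop, one vertex on the path of parents, one list of the queue, or one control operation, with a bounded number of array accesses and of operations on integers; the graph is given by its list of edges and its adjacency lists, and vertices on no edge are not initialized. All choices left open (ties, order in loops) are arbitrary. Proposition. There is an absolute constant $C$ such that the following holds for every finite directed graph $G$ with $m$ edges, every maximal eulerian subgraph $H$ of $G$, and every rank function $r$ that conforms to $H$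 and satisfies $\mathrm{slack}(e,r)\le m$ for all $e\in E(H)$. Every execution of $\mathrm{MinAgony}(G,H,r)$ stops after at most $C(m^2+1)$ steps (that is, the running time is $O(m^2)$), and it ends with a subgraph $H^*$ and a rank function $r^*$ such that $H^*$ is a maximal eulerian subgraph of $G$, $r^*$ conforms to $H^*$, and $a(G,r^*)=|E(H^*)|$. In particular $r^*$ minimizes the agony, $a(G,r^*)\le a(G,r')$ for every $r':V\to\mathbb Z$, and $H^*$ has the largest number of edges among all eulerian subgraphs of $G$. -/

import Mathlib

/-!  Agony of a directed graph, and the algorithm MinAgony as a transition system whose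
single transitions are constant-time operations.

A directed graph on the vertex set `V` is given by its edge set `E : Finset (V × V)`; an edge
`e = (u, v)` goes from `e.1 = u` to `e.2 = v`, and loops are allowed.  A rank function is a map
`r : V → ℤ`. -/

namespace Agony

section Graph

variable {V : Type*}

/-- The agony of an edge `(u, v)`: `max (r u - r v + 1) 0`. -/
def edgeAgony (r : V → ℤ) (e : V × V) : ℤ := max (r e.1 - r e.2 + 1) 0

/-- The agony of a graph: the sum of the agonies of its edges. -/
def agony (E : Finset (V × V)) (r : V → ℤ) : ℤ := ∑ e ∈ E, edgeAgony r e

/-- The slack of an edge `(u, v)`: `max (r v - r u - 1) 0`. -/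
def slack (r : V → ℤ) (e : V × V) : ℤ := max (r e.2 - r e.1 - 1) 0

/-- A graph is eulerian if the out-degree of each vertex equals its in-degree
(connectedness is not required). -/
def IsEulerian [DecidableEq V] (F : Finset (V × V)) : Prop :=
  ∀ v : V, (F.filter (fun e => e.1 = v)).card = (F.filter (fun e => e.2 = v)).card

/-- `F` is a maximal eulerian subgraph of `E`: an eulerian subgraph that is not properly
contained in another eulerian subgraph. -/
def IsMaximalEulerian [DecidableEq V] (E F : Finset (V × V)) : Prop :=
  Maximal (fun F' : Finset (V × V) => F' ⊆ E ∧ IsEulerian F') F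

/-- `F` is a maximum eulerian subgraph of `E`: an eulerian subgraph with the largest number
of edges. -/
def IsMaximumEulerian [DecidableEq V] (E F : Finset (V × V)) : Prop :=
  F ⊆ E ∧ IsEulerian F ∧ ∀ F' : Finset (V × V), F' ⊆ E → IsEulerian F' → F'.card ≤ F.card

/-- `r` conforms to `F`: all edges of `E` that are backward for `r` (that is, `r u ≥ r v`)
belong to `F`. -/
def Conforms (E F : Finset (V × V)) (r : V → ℤ) : Prop :=
  ∀ e ∈ E, r e.2 ≤ r e.1 → e ∈ F

end Graph

section Machine

/-- The memory of the algorithm.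
* `F`: the edge set of the current eulerian subgraph, as one flag per edge.
* `rk`: the rank array that is being modified (during a call of Relief this is the new rank).
* `old`: the rank at the beginning of the current call of Relief.
* `t`: how much a vertex has to be increased.
* `S`: the priority queue.  A vertex `v ∈ S` has priority `t v`.  The queue is an array, indexed
  by priorities, of doubly linked lists: list number `k` contains the `v ∈ S` with `t v = k`.
  Hence a vertex can be inserted, moved to another list or removed, and one list or the whole
  queue can be tested for emptiness, in constant time.
* `top`: the position in the array from which the search for the first nonempty list continues.
* `parent`, `via`: the vertex, and the edge, that caused the last change of `t v`. -/
structure Mem (V : Type*) where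
  F : Finset (V × V)
  rk : V → ℤ
  old : V → ℤ
  t : V → ℤ
  S : Finset V
  top : ℤ
  parent : V → V
  via : V → V × V

/-- The program points, with the local variables that are live there.  In a loop over a set of
edges, `pend` is the set of edges that are still to be treated; the edges are treated one at a
time, in an arbitrary order. -/
inductive Ctrl (V : Type*)
  /-- Main loop: computing the agony (in `a`) and the number of edges of the subgraph (in `c`). -/
  | test (pend : Finset (V × V)) (a : ℤ) (c : ℤ)
  /-- Main loop: searching for an edge of the subgraph with largest slack. -/
  | select (pend : Finset (V × V)) (best : Option (V × V))
  /-- Relief on `(p, s)`: recording the rank and setting `t` to zero. -/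
  | save (p s : V) (pend : Finset (V × V))
  /-- Relief: creating the `k` remaining empty lists of the priority queue. -/
  | create (p s : V) (k : ℕ)
  /-- Relief: head of the loop that runs while the queue is not empty. -/
  | loop (p s : V)
  /-- Relief, visiting `u`: the loop over the edges `(u, v)` outside the subgraph. -/
  | outgoing (p s u : V) (pend : Finset (V × V))
  /-- Relief, visiting `u`: the loop over the edges `(w, u)` of the subgraph. -/
  | incoming (p s u : V) (pend : Finset (V × V))
  /-- Relief: the test after the loop whether `(p, s)` still has positive slack. -/
  | check (p s : V)
  /-- Relief: following the parent links from `s` to `p`; now at `v`. -/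
  | trace (p s v : V)
  /-- The algorithm has stopped. -/
  | done

variable {V : Type*} [DecidableEq V]

/-- Record the current ranks of the end points of `e`, and set `t` to zero there.  (Done for all
edges, this initializes all entries that the algorithm can use: a vertex on no edge is never
looked at.) -/
def Mem.saveEdge (μ : Mem V) (e : V × V) : Mem V :=
  { μ with
    old := Function.update (Function.update μ.old e.1 (μ.rk e.1)) e.2 (μ.rk e.2)
    t := Function.update (Function.update μ.t e.1 0) e.2 0 }

/-- Set `t p` to `r s - r p - 1` and let `p` be the only element of the queue. -/
def Mem.initQueue (μ : Mem V) (p s : V) : Mem V :=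
  { μ with
    t := Function.update μ.t p (μ.rk s - μ.rk p - 1)
    S := {p}
    top := μ.rk s - μ.rk p - 1 }

/-- Remove `u` from the queue and increase its rank by `t u`. -/
def Mem.pop (μ : Mem V) (u : V) : Mem V :=
  { μ with
    S := μ.S.erase u
    rk := Function.update μ.rk u (μ.rk u + μ.t u) }

/-- Set `t v` to `d`, add `v` to the queue with priority `d` (or update its priority),
and let `u` be the parent of `v`, via the edge `e`. -/
def Mem.push (μ : Mem V) (v : V) (d : ℤ) (u : V) (e : V × V) : Mem V :=
  { μ with
    t := Function.update μ.t v d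
    S := insert v μ.S
    top := max μ.top d
    parent := Function.update μ.parent v u
    via := Function.update μ.via v e }

/-- The body of the loop over the edges `e = (u, v)` that are not in the subgraph. -/
def Mem.relaxOut (μ : Mem V) (e : V × V) : Mem V :=
  if e ∉ μ.F ∧ μ.rk e.2 ≤ μ.rk e.1 ∧ μ.t e.2 < μ.rk e.1 + 1 - μ.rk e.2 then
    μ.push e.2 (μ.rk e.1 + 1 - μ.rk e.2) e.1 e
  else μ

/-- The body of the loop over the edges `e = (w, u)` that are in the subgraph. -/
def Mem.relaxIn (μ : Mem V) (e : V × V) : Mem V :=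
  if e ∈ μ.F ∧ slack μ.old e < slack μ.rk e ∧ μ.t e.1 < slack μ.rk e - slack μ.old e then
    μ.push e.1 (slack μ.rk e - slack μ.old e) e.2 e
  else μ

/-- One step of MinAgony on the graph `E`.  Each step reads and writes a bounded number of array
entries and counters, and performs a bounded number of arithmetic operations and comparisons on
integers.  The graph is stored as a list of all edges and, for each vertex, a list of
its outgoing and a list of its incoming edges, so that a loop over `E`, or over the edges out of
or into a vertex, can be entered in one step.  Where the algorithm leaves a choice (among edges
of largest slack, among vertices of highest priority, and in the order in which the edges are
treated in a loop), every possible choice is a step. -/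
inductive Step (E : Finset (V × V)) : Ctrl V × Mem V → Ctrl V × Mem V → Prop
  -- while `agony (G, r) > |E(H)|`
  | test_edge (μ : Mem V) (pend : Finset (V × V)) (a c : ℤ) (e : V × V) (he : e ∈ pend) :
      Step E (.test pend a c, μ)
        (.test (pend.erase e) (a + edgeAgony μ.rk e) (c + if e ∈ μ.F then 1 else 0), μ)
  | test_stop (μ : Mem V) (a c : ℤ) (h : a ≤ c) :
      Step E (.test ∅ a c, μ) (.done, μ)
  | test_continue (μ : Mem V) (a c : ℤ) (h : c < a) :
      Step E (.test ∅ a c, μ) (.select E none, μ)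
  -- `(p, s)` := an edge of `E(H)` with largest slack
  | select_take (μ : Mem V) (pend : Finset (V × V)) (best : Option (V × V)) (e : V × V)
      (he : e ∈ pend) (hF : e ∈ μ.F) (h : ∀ b ∈ best, slack μ.rk b ≤ slack μ.rk e) :
      Step E (.select pend best, μ) (.select (pend.erase e) (some e), μ)
  | select_skip (μ : Mem V) (pend : Finset (V × V)) (best : Option (V × V)) (e : V × V)
      (he : e ∈ pend) (h : e ∉ μ.F ∨ ∃ b ∈ best, slack μ.rk e ≤ slack μ.rk b) :
      Step E (.select pend best, μ) (.select (pend.erase e) best, μ)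
  | select_end (μ : Mem V) (p s : V) :
      Step E (.select ∅ (some (p, s)), μ) (.save p s E, μ)
  -- Relief: initialization
  | save_edge (μ : Mem V) (p s : V) (pend : Finset (V × V)) (e : V × V) (he : e ∈ pend) :
      Step E (.save p s pend, μ) (.save p s (pend.erase e), μ.saveEdge e)
  | save_end (μ : Mem V) (p s : V) :
      Step E (.save p s ∅, μ) (.create p s (μ.rk s - μ.rk p - 1).toNat, μ)
  | create_list (μ : Mem V) (p s : V) (k : ℕ) :
      Step E (.create p s (k + 1), μ) (.create p s k, μ)
  | create_end (μ : Mem V) (p s : V) :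
      Step E (.create p s 0, μ) (.loop p s, μ.initQueue p s)
  -- Relief: while `S` is not empty, take a vertex `u` of highest priority from `S`
  | loop_end (μ : Mem V) (p s : V) (h : μ.S = ∅) :
      Step E (.loop p s, μ) (.check p s, μ)
  | loop_lower (μ : Mem V) (p s : V) (hS : μ.S.Nonempty) (h : ∀ v ∈ μ.S, μ.t v ≠ μ.top) :
      Step E (.loop p s, μ) (.loop p s, { μ with top := μ.top - 1 })
  | loop_pop (μ : Mem V) (p s u : V) (hu : u ∈ μ.S) (h : μ.t u = μ.top) :
      Step E (.loop p s, μ) (.outgoing p s u (E.filter (fun e => e.1 = u)), μ.pop u)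
  -- Relief: for each edge `(u, v)` outside the subgraph
  | outgoing_edge (μ : Mem V) (p s u : V) (pend : Finset (V × V)) (e : V × V) (he : e ∈ pend) :
      Step E (.outgoing p s u pend, μ) (.outgoing p s u (pend.erase e), μ.relaxOut e)
  | outgoing_end (μ : Mem V) (p s u : V) :
      Step E (.outgoing p s u ∅, μ) (.incoming p s u (E.filter (fun e => e.2 = u)), μ)
  -- Relief: for each edge `(w, u)` of the subgraph
  | incoming_edge (μ : Mem V) (p s u : V) (pend : Finset (V × V)) (e : V × V) (he : e ∈ pend) :
      Step E (.incoming p s u pend, μ) (.incoming p s u (pend.erase e), μ.relaxIn e)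
  | incoming_end (μ : Mem V) (p s u : V) :
      Step E (.incoming p s u ∅, μ) (.loop p s, μ)
  -- Relief: if `(p, s)` has positive slack, flip the path from `s` to `p` and delete `(p, s)`
  | check_zero (μ : Mem V) (p s : V) (h : slack μ.rk (p, s) ≤ 0) :
      Step E (.check p s, μ) (.test E 0 0, μ)
  | check_pos (μ : Mem V) (p s : V) (h : 0 < slack μ.rk (p, s)) :
      Step E (.check p s, μ) (.trace p s s, μ)
  | trace_edge (μ : Mem V) (p s v : V) (h : v ≠ p) :
      Step E (.trace p s v, μ)
        (.trace p s (μ.parent v), { μ with F := symmDiff μ.F {μ.via v} })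
  | trace_end (μ : Mem V) (p s : V) :
      Step E (.trace p s p, μ) (.test E 0 0, { μ with F := μ.F.erase (p, s) })

/-- `Steps E n a b`: some execution of `n` steps leads from `a` to `b`. -/
inductive Steps (E : Finset (V × V)) : ℕ → Ctrl V × Mem V → Ctrl V × Mem V → Prop
  | zero (a : Ctrl V × Mem V) : Steps E 0 a a
  | succ {n : ℕ} {a b c : Ctrl V × Mem V} (h : Steps E n a b) (hs : Step E b c) :
      Steps E (n + 1) a c

/-- The call `MinAgony (G, H, r)`: the execution starts at the main loop, with `H` and `r` in
the memory; all other entries of the memory are not initialized, so they may be anything. -/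
def IsStart (E F : Finset (V × V)) (r : V → ℤ) (a : Ctrl V × Mem V) : Prop :=
  a.1 = .test E 0 0 ∧ a.2.F = F ∧ a.2.rk = r

end Machine

end Agony

/-! For every edge `(u, v)`, agony minus slack is `r u - r v + 1`, and rank differences cancel over
an eulerian edge set. Hence the agony carried by an eulerian `F` is `|F|` plus the total slack on
`F`. This is weak duality: no eulerian subgraph has more edges than the agony of any rank
(`IsEulerian.card_le_agony`). For a conforming pair the gap is exactly the total slack
(`Conforms.agony_eq`), so a conforming pair without positive slack is optimal on both sides.

Relief is a Dijkstra search with falling priorities: raising a vertex by `t` never forces another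
one to rise by more than `t`, and never a visited one. So each vertex is visited at most once, and
at the end the new rank conforms and no slack has grown (`Core.relieved`). If `(p, s)` still has
positive slack, then `s` was visited, and every parent link is tight for the new rank. Flipping the
links from `s` to `p` therefore inserts only edges of slack zero and removes only forward edges;
together with the deletion of `(p, s)` it keeps the subgraph eulerian (`Tracing.stable`).

In both cases an edge of positive slack disappears and none appears, so there are at most `m` calls.
A call takes `O(m)` steps because slacks, hence priorities, stay at most `m`. The predicate `Good`
joins these invariants with a bound on the remaining steps; `Good.step` preserves it and
`Good.eq_done` excludes deadlock. -/

namespace Agony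

section EdgeLemmas

variable {V : Type*}

theorem edgeAgony_sub_slack (r : V → ℤ) (e : V × V) :
    edgeAgony r e - slack r e = r e.1 - r e.2 + 1 := by
  unfold edgeAgony slack
  omega

theorem slack_nonneg (r : V → ℤ) (e : V × V) : 0 ≤ slack r e := le_max_right _ _

theorem edgeAgony_nonneg (r : V → ℤ) (e : V × V) : 0 ≤ edgeAgony r e := le_max_right _ _

end EdgeLemmas

/-! ### Eulerian subgraphs: duality, maximality, and the state between two calls of Relief. -/

section GraphLemmas

variable {V : Type*} [DecidableEq V]

/-- Out-degree minus in-degree of `x`. -/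
def excess (F : Finset (V × V)) (x : V) : ℤ :=
  ∑ e ∈ F, ((if e.1 = x then 1 else 0) - (if e.2 = x then 1 else 0))

theorem excess_eq_card_sub_card (F : Finset (V × V)) (x : V) :
    excess F x = ((F.filter (fun e => e.1 = x)).card : ℤ)
      - ((F.filter (fun e => e.2 = x)).card : ℤ) := by
  simp [excess, Finset.sum_sub_distrib]

theorem isEulerian_iff_excess (F : Finset (V × V)) :
    IsEulerian F ↔ ∀ x, excess F x = 0 := by
  refine forall_congr' fun x => ?_
  rw [excess_eq_card_sub_card]
  omega

theorem excess_insert {F : Finset (V × V)} {e : V × V} (he : e ∉ F) (x : V) :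
    excess (insert e F) x =
      (if e.1 = x then 1 else 0) - (if e.2 = x then 1 else 0) + excess F x :=
  Finset.sum_insert he

theorem excess_erase {F : Finset (V × V)} {e : V × V} (he : e ∈ F) (x : V) :
    excess (F.erase e) x =
      excess F x - ((if e.1 = x then 1 else 0) - (if e.2 = x then 1 else 0)) :=
  Finset.sum_erase_eq_sub he

theorem IsEulerian.sum_rank_sub [Fintype V] {F : Finset (V × V)} (hF : IsEulerian F)
    (r : V → ℤ) : ∑ e ∈ F, (r e.1 - r e.2) = 0 := by
  -- Expanding over vertices and swapping the sums makes the excess at `x` the coefficient of `r x`.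
  have h : ∀ e : V × V, r e.1 - r e.2 =
      ∑ x, r x * ((if e.1 = x then 1 else 0) - (if e.2 = x then 1 else 0)) := by
    intro e
    simp [mul_sub, Finset.sum_sub_distrib]
  simp_rw [h]
  rw [Finset.sum_comm]
  refine Finset.sum_eq_zero fun x _ => ?_
  rw [← Finset.mul_sum, show (∑ e ∈ F, (((if e.1 = x then 1 else 0) : ℤ) -
    (if e.2 = x then 1 else 0))) = 0 from (isEulerian_iff_excess F).1 hF x, mul_zero]

theorem IsEulerian.sum_edgeAgony [Fintype V] {F : Finset (V × V)} (hF : IsEulerian F)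
    (r : V → ℤ) : ∑ e ∈ F, edgeAgony r e = F.card + ∑ e ∈ F, slack r e := by
  have h : ∑ e ∈ F, (edgeAgony r e - slack r e) = F.card := by
    simp_rw [edgeAgony_sub_slack]
    rw [Finset.sum_add_distrib, hF.sum_rank_sub]
    simp
  rw [Finset.sum_sub_distrib] at h
  omega

theorem IsEulerian.card_le_agony [Fintype V] {E F : Finset (V × V)} (hF : IsEulerian F)
    (hFE : F ⊆ E) (r : V → ℤ) : (F.card : ℤ) ≤ agony E r := by
  have h1 : ∑ e ∈ F, edgeAgony r e ≤ agony E r :=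
    Finset.sum_le_sum_of_subset_of_nonneg hFE fun e _ _ => edgeAgony_nonneg r e
  have h2 : 0 ≤ ∑ e ∈ F, slack r e := Finset.sum_nonneg fun e _ => slack_nonneg r e
  rw [hF.sum_edgeAgony r] at h1
  omega

theorem Conforms.agony_eq [Fintype V] {E F : Finset (V × V)} {r : V → ℤ}
    (hr : Conforms E F r) (hF : IsEulerian F) (hFE : F ⊆ E) :
    agony E r = F.card + ∑ e ∈ F, slack r e := by
  rw [← hF.sum_edgeAgony r, agony]
  refine (Finset.sum_subset hFE fun e he heF => ?_).symm
  have : ¬ r e.2 ≤ r e.1 := fun h => heF (hr e he h)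
  unfold edgeAgony
  omega

theorem IsEulerian.sdiff {F F' : Finset (V × V)} (hF : IsEulerian F) (hF' : IsEulerian F')
    (h : F ⊆ F') : IsEulerian (F' \ F) := by
  rw [isEulerian_iff_excess] at *
  intro x
  have := Finset.sum_sdiff h
    (f := fun e : V × V => ((if e.1 = x then 1 else 0) - (if e.2 = x then 1 else 0) : ℤ))
  have h1 := hF x
  have h2 := hF' x
  unfold excess at *
  omega

/-- Edges outside `F` strictly increase the rank, so a nonempty set of them cannot have rank
differences summing to zero, as an eulerian one must. Maximality thus needs no invariant of its own.
-/
theorem Conforms.isMaximalEulerian [Fintype V] {E F : Finset (V × V)} {r : V → ℤ}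
    (hr : Conforms E F r) (hF : IsEulerian F) (hFE : F ⊆ E) : IsMaximalEulerian E F := by
  refine ⟨⟨hFE, hF⟩, fun F' hF' hle e he => ?_⟩
  by_contra heF
  have h0 := (hF.sdiff hF'.2 hle).sum_rank_sub r
  have : ∑ e ∈ F' \ F, (r e.1 - r e.2) < 0 := by
    refine Finset.sum_neg (fun e he => ?_) ⟨e, Finset.mem_sdiff.2 ⟨he, heF⟩⟩
    rw [Finset.mem_sdiff] at he
    have : ¬ r e.2 ≤ r e.1 := fun h => he.2 (hr e (hF'.1 he.1) h)
    omega
  omega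

/-- The end points of the edges. -/
def endpoints (E : Finset (V × V)) : Finset V := E.image Prod.fst ∪ E.image Prod.snd

theorem fst_mem_endpoints {E : Finset (V × V)} {e : V × V} (he : e ∈ E) :
    e.1 ∈ endpoints E :=
  Finset.mem_union_left _ (Finset.mem_image_of_mem _ he)

theorem snd_mem_endpoints {E : Finset (V × V)} {e : V × V} (he : e ∈ E) :
    e.2 ∈ endpoints E :=
  Finset.mem_union_right _ (Finset.mem_image_of_mem _ he)

theorem card_endpoints_le (E : Finset (V × V)) : (endpoints E).card ≤ 2 * E.card := by
  have h1 : (E.image Prod.fst).card ≤ E.card := Finset.card_image_le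
  have h2 : (E.image Prod.snd).card ≤ E.card := Finset.card_image_le
  have := Finset.card_union_le (E.image Prod.fst) (E.image Prod.snd)
  unfold endpoints
  omega

/-- The number of steps needed for visiting the vertex `v` in Relief. -/
def visitCost (E : Finset (V × V)) (v : V) : ℕ :=
  (E.filter (fun e => e.1 = v)).card + (E.filter (fun e => e.2 = v)).card + 3

/-- Each edge is counted once at either end. The 3 in `visitCost` stands for the pop and the exits
of the two edge loops; there are at most `2 * |E|` end points, so the total is `(1 + 1 + 6) * |E|`.
-/
theorem sum_visitCost_le (E : Finset (V × V)) :
    ∑ v ∈ endpoints E, visitCost E v ≤ 8 * E.card := by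
  have h1 := Finset.card_eq_sum_card_fiberwise (s := E) (t := endpoints E) (f := Prod.fst)
    fun e he => fst_mem_endpoints he
  have h2 := Finset.card_eq_sum_card_fiberwise (s := E) (t := endpoints E) (f := Prod.snd)
    fun e he => snd_mem_endpoints he
  have h3 := card_endpoints_le E
  simp only [visitCost, Finset.sum_add_distrib, Finset.sum_const, smul_eq_mul]
  omega

/-- `F` is an eulerian subgraph to which `r` conforms, with slacks at most `|E|`, of which at
most `Q` are positive. -/
structure Stable (E F : Finset (V × V)) (r : V → ℤ) (Q : ℕ) : Prop where
  subset : F ⊆ E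
  eulerian : IsEulerian F
  conforms : Conforms E F r
  slack_le : ∀ e ∈ F, slack r e ≤ (E.card : ℤ)
  card_le : (F.filter (fun e => 0 < slack r e)).card ≤ Q

/-- Needed because `old` is initialized only at end points of edges. -/
theorem Stable.congr {E F : Finset (V × V)} {r r' : V → ℤ} {Q : ℕ} (h : Stable E F r Q)
    (hr : ∀ v ∈ endpoints E, r' v = r v) : Stable E F r' Q := by
  have hs : ∀ e ∈ F, slack r' e = slack r e := fun e he => by
    unfold slack
    rw [hr _ (fst_mem_endpoints (h.subset he)), hr _ (snd_mem_endpoints (h.subset he))]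
  refine ⟨h.subset, h.eulerian, fun e he hle => ?_, fun e he => ?_, ?_⟩
  · rw [hr _ (fst_mem_endpoints he), hr _ (snd_mem_endpoints he)] at hle
    exact h.conforms e he hle
  · rw [hs e he]
    exact h.slack_le e he
  · rw [Finset.filter_congr fun e he => by rw [hs e he]]
    exact h.card_le

/-- A change of subgraph and rank that keeps the slacks from growing, that creates no edge of
positive slack and that removes one such edge. -/
theorem Stable.descend {E F F' : Finset (V × V)} {r r' : V → ℤ} {Q : ℕ} {e₀ : V × V}
    (h : Stable E F r (Q + 1)) (he₀ : e₀ ∈ F) (hpos : 0 < slack r e₀)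
    (hsub : F' ⊆ E) (heul : IsEulerian F') (hconf : Conforms E F' r')
    (hle : ∀ e ∈ F', 0 < slack r' e → e ∈ F ∧ slack r' e ≤ slack r e)
    (hne : ∀ e ∈ F', 0 < slack r' e → e ≠ e₀) : Stable E F' r' Q := by
  refine ⟨hsub, heul, hconf, fun e he => ?_, ?_⟩
  · rcases (slack_nonneg r' e).eq_or_lt with h0 | h0
    · rw [← h0]
      positivity
    · exact (hle e he h0).2.trans (h.slack_le e (hle e he h0).1)
  · have hm : e₀ ∈ F.filter (fun e => 0 < slack r e) := Finset.mem_filter.2 ⟨he₀, hpos⟩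
    have hs : F'.filter (fun e => 0 < slack r' e) ⊆
        (F.filter (fun e => 0 < slack r e)).erase e₀ := by
      intro e he
      rw [Finset.mem_filter] at he
      have := hle e he.1 he.2
      exact Finset.mem_erase.2 ⟨hne e he.1 he.2,
        Finset.mem_filter.2 ⟨this.1, he.2.trans_le this.2⟩⟩
    have h1 := Finset.card_le_card hs
    rw [Finset.card_erase_of_mem hm] at h1
    have := h.card_le
    omega

end GraphLemmas

/-! ### The search loop of Relief. -/

section Relief

variable {V : Type*} [DecidableEq V]

/-- The edge `via v` joins `v` to its parent, is tight for the rank `x`, and may be flipped. -/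
def Linked (E F : Finset (V × V)) (old x : V → ℤ) (parent : V → V) (via : V → V × V)
    (v : V) : Prop :=
  via v ∈ E ∧
    ((via v ∉ F ∧ via v = (parent v, v) ∧ x v = x (parent v) + 1) ∨
      (via v ∈ F ∧ via v = (v, parent v) ∧ x v = x (parent v) - 1 - slack old (via v)))

/-- The invariant of the loop of Relief on `(p, s)`.  `D` is the set of visited vertices, `idx v`
is the time of the visit of `v`, and `out` and `inc` are the edges at visited vertices that are
still to be treated. -/
structure Core (E : Finset (V × V)) (p s : V) (Q : ℕ) (μ : Mem V) (D : Finset V) (idx : V → ℕ)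
    (out inc : Finset (V × V)) : Prop where
  stable : Stable E μ.F μ.old (Q + 1)
  mem : (p, s) ∈ μ.F
  t_source : μ.t p = μ.old s - μ.old p - 1
  top_pos : 1 ≤ μ.top
  visited_sub : D ⊆ endpoints E
  queue_sub : μ.S ⊆ endpoints E
  disj : ∀ v ∈ μ.S, v ∉ D
  rk_visited : ∀ v ∈ D, μ.rk v = μ.old v + μ.t v
  rk_unvisited : ∀ v ∈ endpoints E, v ∉ D → μ.rk v = μ.old v
  t_zero : ∀ v ∈ endpoints E, v ∉ D → v ∉ μ.S → μ.t v = 0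
  t_queue : ∀ v ∈ μ.S, 1 ≤ μ.t v ∧ μ.t v ≤ μ.top
  t_visited : ∀ v ∈ D, μ.top ≤ μ.t v
  out_relaxed : ∀ e ∈ E, e ∉ μ.F → e.1 ∈ D → e ∉ out →
    μ.old e.1 + μ.t e.1 + 1 ≤ μ.old e.2 + μ.t e.2
  inc_relaxed : ∀ e ∈ μ.F, e.2 ∈ D → e ∉ inc →
    μ.old e.2 + μ.t e.2 - 1 - slack μ.old e ≤ μ.old e.1 + μ.t e.1
  out_pend : ∀ e ∈ out, e ∈ E ∧ e.1 ∈ D ∧ μ.t e.1 = μ.top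
  inc_pend : ∀ e ∈ inc, e ∈ E ∧ e.2 ∈ D ∧ μ.t e.2 = μ.top
  parent_visited : ∀ v, v ∈ D ∨ v ∈ μ.S → v ≠ p → μ.parent v ∈ D
  linked : ∀ v, v ∈ D ∨ v ∈ μ.S → v ≠ p →
    Linked E μ.F μ.old (fun w => μ.old w + μ.t w) μ.parent μ.via v
  idx_lt : ∀ v ∈ D, v ≠ p → idx (μ.parent v) < idx v
  idx_lt_card : ∀ v ∈ D, idx v < D.card
  source : p ∈ D ∨ (D = ∅ ∧ μ.S = {p})

namespace Core

variable {E : Finset (V × V)} {p s : V} {Q : ℕ} {μ : Mem V} {D : Finset V} {idx : V → ℕ}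
  {out inc : Finset (V × V)}

theorem t_nonneg (h : Core E p s Q μ D idx out inc) {v : V} (hv : v ∈ endpoints E) :
    0 ≤ μ.t v := by
  by_cases hD : v ∈ D
  · have := h.t_visited v hD
    have := h.top_pos
    omega
  · by_cases hS : v ∈ μ.S
    · have := (h.t_queue v hS).1
      omega
    · rw [h.t_zero v hv hD hS]

theorem source_visited (h : Core E p s Q μ D idx out inc) {u : V} (hu : u ∈ D) : p ∈ D := by
  rcases h.source with h | ⟨h, -⟩
  · exact h
  · simp [h] at hu

theorem erase_out (h : Core E p s Q μ D idx out inc) (e : V × V)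
    (he : e ∉ μ.F → μ.old e.1 + μ.t e.1 + 1 ≤ μ.old e.2 + μ.t e.2) :
    Core E p s Q μ D idx (out.erase e) inc :=
  { h with
    out_relaxed := fun e' h1 h2 h3 h4 => by
      by_cases hee : e' = e
      · rw [hee] at h2 ⊢
        exact he h2
      · exact h.out_relaxed e' h1 h2 h3 fun h5 => h4 (Finset.mem_erase.2 ⟨hee, h5⟩)
    out_pend := fun e' he' => h.out_pend e' (Finset.mem_of_mem_erase he') }

theorem erase_inc (h : Core E p s Q μ D idx out inc) (e : V × V)
    (he : e ∈ μ.F → μ.old e.2 + μ.t e.2 - 1 - slack μ.old e ≤ μ.old e.1 + μ.t e.1) :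
    Core E p s Q μ D idx out (inc.erase e) :=
  { h with
    inc_relaxed := fun e' h1 h2 h3 => by
      by_cases hee : e' = e
      · rw [hee] at h1 ⊢
        exact he h1
      · exact h.inc_relaxed e' h1 h2 fun h5 => h3 (Finset.mem_erase.2 ⟨hee, h5⟩)
    inc_pend := fun e' he' => h.inc_pend e' (Finset.mem_of_mem_erase he') }

/-- Since `v` is unvisited and its `t` only grows, the inequalities already secured at visited
vertices survive; since `d` is at most `top`, the priorities stay monotone. -/
theorem push (h : Core E p s Q μ D idx out inc) {v u : V} {d : ℤ} {e : V × V}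
    (hvE : v ∈ endpoints E) (hv : v ∉ D) (hu : u ∈ D) (htd : μ.t v < d) (hd : d ≤ μ.top)
    (he : e ∈ E)
    (hl : (e ∉ μ.F ∧ e = (u, v) ∧ μ.old v + d = μ.old u + μ.t u + 1) ∨
      (e ∈ μ.F ∧ e = (v, u) ∧ μ.old v + d = μ.old u + μ.t u - 1 - slack μ.old e)) :
    Core E p s Q (μ.push v d u e) D idx out inc := by
  have ht0 := h.t_nonneg hvE
  have htop : max μ.top d = μ.top := max_eq_left hd
  have hp := h.source_visited hu
  have hD : ∀ w ∈ D, Function.update μ.t v d w = μ.t w := fun w hw =>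
    Function.update_of_ne (fun hwv : w = v => hv (hwv ▸ hw)) _ _
  have hge : ∀ w, μ.t w ≤ Function.update μ.t v d w := fun w => by
    by_cases hw : w = v
    · subst hw
      rw [Function.update_self]
      exact htd.le
    · rw [Function.update_of_ne hw]
  have hmem : ∀ w, w ≠ v → w ∈ D ∨ w ∈ insert v μ.S → w ∈ D ∨ w ∈ μ.S := fun w hw hh =>
    hh.imp_right fun hh => Finset.mem_of_mem_insert_of_ne hh hw
  constructor
  · exact h.stable
  · exact h.mem
  · exact (hD p hp).trans h.t_source
  · exact h.top_pos.trans (le_max_left _ _)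
  · exact h.visited_sub
  · exact Finset.insert_subset hvE h.queue_sub
  · intro w hw
    rcases Finset.mem_insert.1 hw with rfl | hw
    · exact hv
    · exact h.disj w hw
  · intro w hw
    simpa only [Mem.push, hD w hw] using h.rk_visited w hw
  · exact h.rk_unvisited
  · intro w hw hwD hwS
    have hwv : w ≠ v := fun hwv => hwS (Finset.mem_insert.2 (Or.inl hwv))
    simpa only [Mem.push, Function.update_of_ne hwv] using
      h.t_zero w hw hwD fun hh => hwS (Finset.mem_insert_of_mem hh)
  · intro w hw
    simp only [Mem.push, htop]
    by_cases hwv : w = v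
    · subst hwv
      rw [Function.update_self]
      exact ⟨by omega, hd⟩
    · rw [Function.update_of_ne hwv]
      exact h.t_queue w (Finset.mem_of_mem_insert_of_ne hw hwv)
  · intro w hw
    simpa only [Mem.push, htop, hD w hw] using h.t_visited w hw
  · intro e' h1 h2 h3 h4
    have := h.out_relaxed e' h1 h2 h3 h4
    have := hge e'.2
    simp only [Mem.push, hD _ h3]
    omega
  · intro e' h1 h2 h3
    have := h.inc_relaxed e' h1 h2 h3
    have := hge e'.1
    simp only [Mem.push, hD _ h2]
    omega
  · intro e' he'
    obtain ⟨h1, h2, h3⟩ := h.out_pend e' he'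
    exact ⟨h1, h2, by simpa only [Mem.push, htop, hD _ h2] using h3⟩
  · intro e' he'
    obtain ⟨h1, h2, h3⟩ := h.inc_pend e' he'
    exact ⟨h1, h2, by simpa only [Mem.push, htop, hD _ h2] using h3⟩
  · intro w hw hwp
    simp only [Mem.push]
    by_cases hwv : w = v
    · subst hwv
      rwa [Function.update_self]
    · rw [Function.update_of_ne hwv]
      exact h.parent_visited w (hmem w hwv hw) hwp
  · intro w hw hwp
    simp only [Mem.push, Linked]
    by_cases hwv : w = v
    · subst hwv
      simp only [Function.update_self, hD u hu]
      exact ⟨he, hl⟩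
    · simp only [Function.update_of_ne hwv,
        hD _ (h.parent_visited w (hmem w hwv hw) hwp)]
      exact h.linked w (hmem w hwv hw) hwp
  · intro w hw hwp
    have hwv : w ≠ v := fun hwv => hv (hwv ▸ hw)
    simpa only [Mem.push, Function.update_of_ne hwv] using h.idx_lt w hw hwp
  · exact h.idx_lt_card
  · exact Or.inl hp

theorem relaxOut (h : Core E p s Q μ D idx out inc) {e : V × V} (he : e ∈ out) :
    (μ.relaxOut e).top = μ.top ∧ Core E p s Q (μ.relaxOut e) D idx (out.erase e) inc := by
  obtain ⟨heE, heD, het⟩ := h.out_pend e he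
  have hrk := h.rk_visited _ heD
  unfold Mem.relaxOut
  split_ifs with hc
  · obtain ⟨h1, h2, h3⟩ := hc
    have hconf : ¬ μ.old e.2 ≤ μ.old e.1 := fun hh => h1 (h.stable.conforms e heE hh)
    -- A visited head has risen by at least `top`, which is the rise of the tail, and by conformity
    -- it started above the tail; so it would still be above.
    have hvD : e.2 ∉ D := fun hv => by
      have := h.rk_visited _ hv
      have := h.t_visited _ hv
      omega
    have hrk2 := h.rk_unvisited _ (snd_mem_endpoints heE) hvD
    have hne : e.1 ≠ e.2 := fun hh => hvD (hh ▸ heD)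
    -- The new priority is at most `top` because `old e.1 + 1 ≤ old e.2`.
    refine ⟨max_eq_left (by omega), (h.push (snd_mem_endpoints heE) hvD heD h3 (by omega) heE
      (Or.inl ⟨h1, rfl, by omega⟩)).erase_out e fun _ => ?_⟩
    simp only [Mem.push, Function.update_self, Function.update_of_ne hne]
    omega
  · refine ⟨rfl, h.erase_out e fun h1 => ?_⟩
    have hconf : ¬ μ.old e.2 ≤ μ.old e.1 := fun hh => h1 (h.stable.conforms e heE hh)
    have h0 := h.t_nonneg (snd_mem_endpoints heE)
    by_cases hvD : e.2 ∈ D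
    · have := h.t_visited _ hvD
      omega
    · have := h.rk_unvisited _ (snd_mem_endpoints heE) hvD
      have : ¬ (μ.rk e.2 ≤ μ.rk e.1 ∧ μ.t e.2 < μ.rk e.1 + 1 - μ.rk e.2) :=
        fun hh => hc ⟨h1, hh⟩
      omega

theorem relaxIn (h : Core E p s Q μ D idx out inc) {e : V × V} (he : e ∈ inc) :
    (μ.relaxIn e).top = μ.top ∧ Core E p s Q (μ.relaxIn e) D idx out (inc.erase e) := by
  obtain ⟨heE, heD, het⟩ := h.inc_pend e he
  have hrk := h.rk_visited _ heD
  have h0 := h.t_nonneg (fst_mem_endpoints heE)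
  have hso : slack μ.old e = max (μ.old e.2 - μ.old e.1 - 1) 0 := rfl
  have hsr : slack μ.rk e = max (μ.rk e.2 - μ.rk e.1 - 1) 0 := rfl
  unfold Mem.relaxIn
  split_ifs with hc
  · obtain ⟨h1, h2, h3⟩ := hc
    -- The slack grows only if the tail has risen less than the head, but a visited tail has risen
    -- by at least `top`, the rise of the head.
    have hvD : e.1 ∉ D := fun hv => by
      have := h.rk_visited _ hv
      have := h.t_visited _ hv
      omega
    have hrk2 := h.rk_unvisited _ (fst_mem_endpoints heE) hvD
    have hne : e.2 ≠ e.1 := fun hh => hvD (hh ▸ heD)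
    refine ⟨max_eq_left (by omega), (h.push (fst_mem_endpoints heE) hvD heD h3 (by omega) heE
      (Or.inr ⟨h1, rfl, by omega⟩)).erase_inc e fun _ => ?_⟩
    simp only [Mem.push, Function.update_self, Function.update_of_ne hne]
    omega
  · refine ⟨rfl, h.erase_inc e fun h1 => ?_⟩
    by_cases hvD : e.1 ∈ D
    · have := h.t_visited _ hvD
      omega
    · have := h.rk_unvisited _ (fst_mem_endpoints heE) hvD
      have : ¬ (slack μ.old e < slack μ.rk e ∧ μ.t e.1 < slack μ.rk e - slack μ.old e) :=
        fun hh => hc ⟨h1, hh⟩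
      omega

/-- The time stamp `D.card` exceeds all earlier ones, so times fall along parent links. Only edges
at `u` become pending. -/
theorem pop (h : Core E p s Q μ D idx ∅ ∅) {u : V} (hu : u ∈ μ.S) (htu : μ.t u = μ.top) :
    Core E p s Q (μ.pop u) (insert u D) (Function.update idx u D.card)
      (E.filter (fun e => e.1 = u)) (E.filter (fun e => e.2 = u)) := by
  have huD := h.disj u hu
  have huE := h.queue_sub hu
  have hne : ∀ w ∈ D, w ≠ u := fun w hw hwu => huD (hwu ▸ hw)
  have hmem : ∀ w, w ∈ insert u D ∨ w ∈ μ.S.erase u → w ∈ D ∨ w ∈ μ.S := by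
    rintro w (hw | hw)
    · rcases Finset.mem_insert.1 hw with rfl | hw
      · exact Or.inr hu
      · exact Or.inl hw
    · exact Or.inr (Finset.mem_of_mem_erase hw)
  constructor
  · exact h.stable
  · exact h.mem
  · exact h.t_source
  · exact h.top_pos
  · exact Finset.insert_subset huE h.visited_sub
  · exact (Finset.erase_subset _ _).trans h.queue_sub
  · intro w hw hw'
    obtain ⟨h1, h2⟩ := Finset.mem_erase.1 hw
    exact h.disj w h2 (Finset.mem_of_mem_insert_of_ne hw' h1)
  · intro w hw
    simp only [Mem.pop]
    rcases Finset.mem_insert.1 hw with rfl | hw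
    · rw [Function.update_self, h.rk_unvisited _ huE huD]
    · rw [Function.update_of_ne (hne w hw), h.rk_visited w hw]
  · intro w hw hwD
    rw [Finset.mem_insert, not_or] at hwD
    simp only [Mem.pop, Function.update_of_ne hwD.1]
    exact h.rk_unvisited w hw hwD.2
  · intro w hw hwD hwS
    rw [Finset.mem_insert, not_or] at hwD
    exact h.t_zero w hw hwD.2 fun hh => hwS (Finset.mem_erase.2 ⟨hwD.1, hh⟩)
  · intro w hw
    exact h.t_queue w (Finset.mem_of_mem_erase hw)
  · intro w hw
    rcases Finset.mem_insert.1 hw with rfl | hw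
    · exact htu.ge
    · exact h.t_visited w hw
  · intro e h1 h2 h3 h4
    refine h.out_relaxed e h1 h2 (Finset.mem_of_mem_insert_of_ne h3 fun hh => h4 ?_)
      (Finset.notMem_empty e)
    exact Finset.mem_filter.2 ⟨h1, hh⟩
  · intro e h1 h2 h3
    refine h.inc_relaxed e h1 (Finset.mem_of_mem_insert_of_ne h2 fun hh => h3 ?_)
      (Finset.notMem_empty e)
    exact Finset.mem_filter.2 ⟨h.stable.subset h1, hh⟩
  · intro e he
    obtain ⟨h1, h2⟩ := Finset.mem_filter.1 he
    exact ⟨h1, h2 ▸ Finset.mem_insert_self _ _, h2 ▸ htu⟩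
  · intro e he
    obtain ⟨h1, h2⟩ := Finset.mem_filter.1 he
    exact ⟨h1, h2 ▸ Finset.mem_insert_self _ _, h2 ▸ htu⟩
  · intro w hw hwp
    exact Finset.mem_insert_of_mem (h.parent_visited w (hmem w hw) hwp)
  · intro w hw hwp
    exact h.linked w (hmem w hw) hwp
  · intro w hw hwp
    have hpar := h.parent_visited w (hmem w (Or.inl hw)) hwp
    simp only [Mem.pop]
    rw [Function.update_of_ne (hne _ hpar)]
    by_cases hwu : w = u
    · subst hwu
      rw [Function.update_self]
      exact h.idx_lt_card _ hpar
    · rw [Function.update_of_ne hwu]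
      exact h.idx_lt w (Finset.mem_of_mem_insert_of_ne hw hwu) hwp
  · intro w hw
    rw [Finset.card_insert_of_notMem huD]
    by_cases hwu : w = u
    · subst hwu
      rw [Function.update_self]
      omega
    · rw [Function.update_of_ne hwu]
      have := h.idx_lt_card w (Finset.mem_of_mem_insert_of_ne hw hwu)
      omega
  · left
    rcases h.source with hp | ⟨-, hS⟩
    · exact Finset.mem_insert_of_mem hp
    · rw [hS, Finset.mem_singleton] at hu
      exact hu ▸ Finset.mem_insert_self _ _

/-- Priorities in the queue are at least 1 and here differ from `top`, so `top` is at least 2; thus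
`top.toNat` really drops. -/
theorem lower (h : Core E p s Q μ D idx ∅ ∅) (hS : μ.S.Nonempty)
    (ht : ∀ v ∈ μ.S, μ.t v ≠ μ.top) :
    2 ≤ μ.top ∧ Core E p s Q { μ with top := μ.top - 1 } D idx ∅ ∅ := by
  obtain ⟨v, hv⟩ := hS
  have h2 : 2 ≤ μ.top := by
    have := h.t_queue v hv
    have := ht v hv
    omega
  refine ⟨h2, { h with
    top_pos := ?_, t_queue := ?_, t_visited := ?_, out_pend := ?_, inc_pend := ?_ }⟩
  · change 1 ≤ μ.top - 1
    omega
  · intro w hw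
    change 1 ≤ μ.t w ∧ μ.t w ≤ μ.top - 1
    have := h.t_queue w hw
    have := ht w hw
    omega
  · intro w hw
    change μ.top - 1 ≤ μ.t w
    have := h.t_visited w hw
    omega
  · simp
  · simp

theorem init (h : Stable E μ.F μ.rk (Q + 1)) (hps : (p, s) ∈ μ.F)
    (hpos : 0 < slack μ.rk (p, s)) (hold : ∀ v ∈ endpoints E, μ.old v = μ.rk v)
    (ht : ∀ v ∈ endpoints E, μ.t v = 0) :
    Core E p s Q (μ.initQueue p s) ∅ (fun _ => 0) ∅ ∅ := by
  have hp := fst_mem_endpoints (h.subset hps)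
  have hs := snd_mem_endpoints (h.subset hps)
  have h1 : 1 ≤ μ.rk s - μ.rk p - 1 := by
    unfold slack at hpos
    simp only at hpos
    omega
  constructor
  · exact h.congr hold
  · exact hps
  · simp only [Mem.initQueue, Function.update_self]
    rw [hold p hp, hold s hs]
  · exact h1
  · simp
  · simpa [Mem.initQueue] using hp
  · simp
  · simp
  · intro v hv _
    exact (hold v hv).symm
  · intro v hv _ hvS
    have hvp : v ≠ p := by simpa [Mem.initQueue] using hvS
    simpa only [Mem.initQueue, Function.update_of_ne hvp] using ht v hv
  · intro v hv
    have hvp : v = p := by simpa [Mem.initQueue] using hv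
    subst hvp
    simp only [Mem.initQueue, Function.update_self]
    exact ⟨h1, le_rfl⟩
  · simp
  · simp
  · simp
  · simp
  · simp
  · intro v hv hvp
    simp [Mem.initQueue, hvp] at hv
  · intro v hv hvp
    simp [Mem.initQueue, hvp] at hv
  · simp
  · simp
  · exact Or.inr ⟨rfl, rfl⟩

end Core

/-- The outcome of the loop of Relief on `(p, s)`, with subgraph `F`, old rank `old` and new rank
`rk`; `D` is the set of visited vertices and `idx v` is the time of the visit of `v`. -/
structure Relieved (E : Finset (V × V)) (p s : V) (Q : ℕ) (F : Finset (V × V)) (old rk : V → ℤ)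
    (parent : V → V) (via : V → V × V) (D : Finset V) (idx : V → ℕ) : Prop where
  stable : Stable E F old (Q + 1)
  mem : (p, s) ∈ F
  pos : 0 < slack old (p, s)
  conforms : Conforms E F rk
  slack_le : ∀ e ∈ F, slack rk e ≤ slack old e
  target : 0 < slack rk (p, s) → s ∈ D
  parent_visited : ∀ v ∈ D, v ≠ p → parent v ∈ D
  linked : ∀ v ∈ D, v ≠ p → Linked E F old rk parent via v
  idx_lt : ∀ v ∈ D, v ≠ p → idx (parent v) < idx v
  idx_bound : ∀ v ∈ D, idx v < 2 * E.card

/-- With an empty queue, `rk = old + t` at every end point, so the relaxation inequalities become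
statements about the new rank. -/
theorem Core.relieved {E : Finset (V × V)} {p s : V} {Q : ℕ} {μ : Mem V} {D : Finset V}
    {idx : V → ℕ} (h : Core E p s Q μ D idx ∅ ∅) (hS : μ.S = ∅) :
    Relieved E p s Q μ.F μ.old μ.rk μ.parent μ.via D idx := by
  have hpD : p ∈ D := by
    rcases h.source with hp | ⟨-, hp⟩
    · exact hp
    · simp [hS] at hp
  have hrk : ∀ v ∈ endpoints E, μ.rk v = μ.old v + μ.t v := fun v hv => by
    by_cases hD : v ∈ D
    · exact h.rk_visited v hD
    · rw [h.rk_unvisited v hv hD, h.t_zero v hv hD (by simp [hS]), add_zero]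
  have hsE := snd_mem_endpoints (h.stable.subset h.mem)
  have hpp := h.rk_visited p hpD
  have htp := h.t_source
  constructor
  · exact h.stable
  · exact h.mem
  · have := h.t_visited p hpD
    have := h.top_pos
    unfold slack
    simp only
    omega
  · intro e he hle
    by_contra heF
    have h1 := hrk _ (fst_mem_endpoints he)
    have h2 := hrk _ (snd_mem_endpoints he)
    have h3 := h.t_nonneg (snd_mem_endpoints he)
    by_cases hD : e.1 ∈ D
    · have := h.out_relaxed e he heF hD (Finset.notMem_empty _)
      omega
    -- An unvisited tail keeps its rank while the head can only rise.
    · have : ¬ μ.old e.2 ≤ μ.old e.1 := fun hh => heF (h.stable.conforms e he hh)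
      have := h.rk_unvisited _ (fst_mem_endpoints he) hD
      omega
  · intro e heF
    have he := h.stable.subset heF
    have h1 := hrk _ (fst_mem_endpoints he)
    have h2 := hrk _ (snd_mem_endpoints he)
    have h3 := h.t_nonneg (fst_mem_endpoints he)
    have hso : slack μ.old e = max (μ.old e.2 - μ.old e.1 - 1) 0 := rfl
    have hsr : slack μ.rk e = max (μ.rk e.2 - μ.rk e.1 - 1) 0 := rfl
    by_cases hD : e.2 ∈ D
    · have := h.inc_relaxed e heF hD (Finset.notMem_empty _)
      omega
    · have := h.rk_unvisited _ (snd_mem_endpoints he) hD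
      omega
  · intro hpos
    -- If `s` kept its rank, the rise of `p` by the full slack would leave slack zero.
    by_contra hD
    have h1 := h.rk_unvisited s hsE hD
    unfold slack at hpos
    simp only at hpos
    omega
  · exact fun v hv hvp => h.parent_visited v (Or.inl hv) hvp
  · intro v hv hvp
    have := h.linked v (Or.inl hv) hvp
    unfold Linked at this ⊢
    rwa [h.rk_visited v hv, h.rk_visited _ (h.parent_visited v (Or.inl hv) hvp)]
  · exact h.idx_lt
  · intro v hv
    have h1 := h.idx_lt_card v hv
    have h2 := Finset.card_le_card h.visited_sub
    have h3 := card_endpoints_le E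
    omega

/-! ### The outcome of the search. -/

namespace Relieved

variable {E : Finset (V × V)} {p s : V} {Q : ℕ} {F F' : Finset (V × V)} {old rk : V → ℤ}
  {parent : V → V} {via : V → V × V} {D : Finset V} {idx : V → ℕ}

theorem stable_of_slack_zero (h : Relieved E p s Q F old rk parent via D idx)
    (h0 : slack rk (p, s) ≤ 0) : Stable E F rk Q :=
  h.stable.descend h.mem h.pos h.stable.subset h.stable.eulerian h.conforms
    (fun e he _ => ⟨he, h.slack_le e he⟩) fun e _ hpos hee => by
      rw [hee] at hpos
      omega

theorem via_ne (h : Relieved E p s Q F old rk parent via D idx) {v : V} (hv : v ∈ D)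
    (hvp : v ≠ p) : via v ≠ (p, s) := by
  intro hh
  rcases (h.linked v hv hvp).2 with ⟨h1, -⟩ | ⟨-, h1, -⟩
  · exact h1 (hh ▸ h.mem)
  · rw [hh] at h1
    exact hvp (congrArg Prod.fst h1).symm

/-- A link outside `F` has the child as its head, a link in `F` has it as its tail. Hence no edge is
flipped twice. -/
theorem via_injective (h : Relieved E p s Q F old rk parent via D idx) {v w : V} (hv : v ∈ D)
    (hvp : v ≠ p) (hw : w ∈ D) (hwp : w ≠ p) (hvw : via v = via w) : v = w := by
  rcases (h.linked v hv hvp).2 with ⟨h1, h2, -⟩ | ⟨h1, h2, -⟩ <;>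
  rcases (h.linked w hw hwp).2 with ⟨h3, h4, -⟩ | ⟨h3, h4, -⟩
  · exact congrArg Prod.snd (h2.symm.trans (hvw.trans h4))
  · exact absurd (hvw ▸ h3) h1
  · exact absurd (hvw ▸ h1) h3
  · exact congrArg Prod.fst (h2.symm.trans (hvw.trans h4))

end Relieved

/-- The state while the path of parents is followed from `s` to `p`, at the vertex `v`: `F` is
the subgraph before the flips and `F'` is the current one. -/
structure Tracing (E : Finset (V × V)) (p s : V) (F F' : Finset (V × V)) (rk : V → ℤ)
    (via : V → V × V) (D : Finset V) (idx : V → ℕ) (v : V) : Prop where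
  at_mem : v ∈ D
  subset : F' ⊆ E
  conforms : Conforms E F' rk
  excess_eq : ∀ x, excess F' x = (if v = x then 1 else 0) - (if s = x then 1 else 0)
  old_of_pos : ∀ e ∈ F', 0 < slack rk e → e ∈ F
  mem : (p, s) ∈ F'
  untouched : ∀ w ∈ D, w ≠ p → idx w ≤ idx v → (via w ∈ F' ↔ via w ∈ F)

/-! ### Flipping the path of parents. -/

namespace Tracing

variable {E : Finset (V × V)} {p s : V} {Q : ℕ} {F F' : Finset (V × V)} {old rk : V → ℤ}
  {parent : V → V} {via : V → V × V} {D : Finset V} {idx : V → ℕ} {v : V}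

theorem start (h : Relieved E p s Q F old rk parent via D idx) (hpos : 0 < slack rk (p, s)) :
    Tracing E p s F F rk via D idx s where
  at_mem := h.target hpos
  subset := h.stable.subset
  conforms := h.conforms
  excess_eq x := by rw [(isEulerian_iff_excess F).1 h.stable.eulerian x, sub_self]
  old_of_pos e he _ := he
  mem := h.mem
  untouched _ _ _ _ := Iff.rfl

theorem step (ht : Tracing E p s F F' rk via D idx v)
    (h : Relieved E p s Q F old rk parent via D idx) (hvp : v ≠ p) :
    Tracing E p s F (symmDiff F' {via v}) rk via D idx (parent v) := by
  have hv := ht.at_mem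
  have hlt := h.idx_lt v hv hvp
  have hiff := ht.untouched v hv hvp le_rfl
  have hmem : ∀ e, e ≠ via v → (e ∈ symmDiff F' {via v} ↔ e ∈ F') := fun e he => by
    simp [Finset.mem_symmDiff, he]
  have hvia : via v ∈ symmDiff F' {via v} ↔ via v ∉ F' := by
    simp [Finset.mem_symmDiff]
  obtain ⟨hE, hl⟩ := h.linked v hv hvp
  constructor
  · exact h.parent_visited v hv hvp
  · intro e he
    by_cases hee : e = via v
    · exact hee ▸ hE
    · exact ht.subset ((hmem e hee).1 he)
  · intro e he hle
    by_cases hee : e = via v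
    · subst hee
      rw [hvia, hiff]
      rcases hl with ⟨h1, -⟩ | ⟨h1, h2, h3⟩
      · exact h1
      -- A removed link goes strictly up in the new rank, so conformity does not require it.
      · exfalso
        have := slack_nonneg old (via v)
        rw [h2] at hle
        change rk (parent v) ≤ rk v at hle
        omega
    · exact (hmem e hee).2 (ht.conforms e he hle)
  · intro x
    have hx := ht.excess_eq x
    rcases hl with ⟨h1, h2, -⟩ | ⟨h1, h2, -⟩
    · rw [← hiff] at h1
      have hs : symmDiff F' {via v} = insert (via v) F' := by
        rw [← Finset.union_singleton, Disjoint.symmDiff_eq_sup]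
        · rfl
        · simpa using h1
      rw [hs, excess_insert h1, hx, h2]
      simp only
      ring
    · rw [← hiff] at h1
      have hs : symmDiff F' {via v} = F'.erase (via v) := by
        ext e
        by_cases hee : e = via v
        · subst hee
          simp [hvia, h1]
        · simp [hmem e hee, hee]
      rw [hs, excess_erase h1, hx, h2]
      simp only
      ring
  · intro e he hpos
    by_cases hee : e = via v
    · subst hee
      rw [hvia, hiff] at he
      rcases hl with ⟨-, h2, h3⟩ | ⟨h1, -⟩
      -- An inserted link rises by exactly one, so its slack is zero.
      · exfalso
        rw [h2] at hpos
        unfold slack at hpos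
        simp only at hpos
        omega
      · exact h1
    · exact ht.old_of_pos e ((hmem e hee).1 he) hpos
  · exact (hmem _ (h.via_ne hv hvp).symm).2 ht.mem
  · intro w hw hwp hwi
    have hwv : via w ≠ via v := fun hh => by
      rw [h.via_injective hw hwp hv hvp hh] at hwi
      omega
    rw [hmem _ hwv]
    exact ht.untouched w hw hwp (by omega)

/-- At `p` the excess of `F'` is that of the single edge `(p, s)`, so deleting this edge restores
balance. -/
theorem stable (ht : Tracing E p s F F' rk via D idx p)
    (h : Relieved E p s Q F old rk parent via D idx) (hpos : 0 < slack rk (p, s)) :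
    Stable E (F'.erase (p, s)) rk Q := by
  refine h.stable.descend h.mem h.pos ((Finset.erase_subset _ _).trans ht.subset) ?_ ?_ ?_ ?_
  · rw [isEulerian_iff_excess]
    intro x
    rw [excess_erase ht.mem, ht.excess_eq, sub_self]
  · intro e he hle
    refine Finset.mem_erase.2 ⟨fun hee => ?_, ht.conforms e he hle⟩
    rw [hee] at hle
    unfold slack at hpos
    simp only at hpos hle
    omega
  · intro e he hp
    have heF := ht.old_of_pos e (Finset.mem_of_mem_erase he) hp
    exact ⟨heF, h.slack_le e heF⟩
  · exact fun e he _ => Finset.ne_of_mem_erase he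

end Tracing

end Relief

/-! ### The step budget. -/

section Cost

variable {V : Type*}

/-- A bound for the number of steps from the beginning of the main loop, if at most `Q` edges of
the subgraph have positive slack. -/
def testCost (E : Finset (V × V)) (Q : ℕ) : ℕ := Q * (15 * E.card + 6) + E.card + 1

/-- One round: `test`, `select`, `save`, `create` and the lowering of `top` cost `m` each, the
visits `8m`, the path `2m`. The 6 counts the exits of the first four phases and of the queue loop,
and the check; the end of the path is covered by the `2m`. -/
theorem testCost_succ (E : Finset (V × V)) (Q : ℕ) :
    testCost E (Q + 1) = testCost E Q + (15 * E.card + 6) := by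
  unfold testCost
  ring

end Cost

/-! ### Invariant and termination of the whole execution. -/

section Execution

variable {V : Type*} [DecidableEq V]

/-- The invariant of the algorithm: at this configuration all is well, and at most `k` more
steps will be made. -/
def Good (E : Finset (V × V)) (k : ℕ) : Ctrl V × Mem V → Prop
  | (.test pend a c, μ) => ∃ Q, Stable E μ.F μ.rk Q ∧
      a + ∑ e ∈ pend, edgeAgony μ.rk e = agony E μ.rk ∧
      c + ∑ e ∈ pend, (if e ∈ μ.F then 1 else 0) = (μ.F.card : ℤ) ∧
      testCost E Q + pend.card ≤ k + E.card
  | (.select pend best, μ) => ∃ Q, Stable E μ.F μ.rk (Q + 1) ∧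
      (∃ e ∈ μ.F, 0 < slack μ.rk e) ∧ (∀ b ∈ best, b ∈ μ.F) ∧
      (∀ e ∈ μ.F, e ∉ pend → ∃ b ∈ best, slack μ.rk e ≤ slack μ.rk b) ∧
      testCost E Q + 13 * E.card + 5 + pend.card ≤ k
  | (.save p s pend, μ) => ∃ Q, Stable E μ.F μ.rk (Q + 1) ∧ (p, s) ∈ μ.F ∧
      0 < slack μ.rk (p, s) ∧
      (∀ v ∈ endpoints (E \ pend), μ.old v = μ.rk v ∧ μ.t v = 0) ∧
      testCost E Q + 12 * E.card + 4 + pend.card ≤ k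
  | (.create p s n, μ) => ∃ Q, Stable E μ.F μ.rk (Q + 1) ∧ (p, s) ∈ μ.F ∧
      0 < slack μ.rk (p, s) ∧
      (∀ v ∈ endpoints E, μ.old v = μ.rk v ∧ μ.t v = 0) ∧
      testCost E Q + 11 * E.card + 3 + n ≤ k
  | (.loop p s, μ) => ∃ Q D idx, Core E p s Q μ D idx ∅ ∅ ∧
      testCost E Q + 2 * E.card + 2 + μ.top.toNat +
        ∑ v ∈ endpoints E \ D, visitCost E v ≤ k
  | (.outgoing p s u pend, μ) => ∃ Q D idx,
      Core E p s Q μ D idx pend (E.filter (fun e => e.2 = u)) ∧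
      testCost E Q + 2 * E.card + 2 + μ.top.toNat +
        ∑ v ∈ endpoints E \ D, visitCost E v +
        (E.filter (fun e => e.2 = u)).card + pend.card + 2 ≤ k
  | (.incoming p s _ pend, μ) => ∃ Q D idx, Core E p s Q μ D idx ∅ pend ∧
      testCost E Q + 2 * E.card + 2 + μ.top.toNat +
        ∑ v ∈ endpoints E \ D, visitCost E v + pend.card + 1 ≤ k
  | (.check p s, μ) => ∃ Q D idx, Relieved E p s Q μ.F μ.old μ.rk μ.parent μ.via D idx ∧
      testCost E Q + 2 * E.card + 1 ≤ k
  | (.trace p s v, μ) => ∃ Q F D idx, Relieved E p s Q F μ.old μ.rk μ.parent μ.via D idx ∧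
      0 < slack μ.rk (p, s) ∧ Tracing E p s F μ.F μ.rk μ.via D idx v ∧
      testCost E Q + idx v + 1 ≤ k
  | (.done, μ) => ∃ Q, Stable E μ.F μ.rk Q ∧ agony E μ.rk ≤ μ.F.card

theorem sum_mem_eq_card {E F : Finset (V × V)} (h : F ⊆ E) :
    ∑ e ∈ E, (if e ∈ F then 1 else 0) = (F.card : ℤ) := by
  rw [Finset.sum_boole, Finset.filter_mem_eq_inter, Finset.inter_eq_right.2 h]

theorem Stable.good_test {E : Finset (V × V)} {μ : Mem V} {Q k : ℕ}
    (h : Stable E μ.F μ.rk Q) (hk : testCost E Q ≤ k) : Good E k (.test E 0 0, μ) :=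
  ⟨Q, h, zero_add _, by rw [zero_add, sum_mem_eq_card h.subset], by omega⟩

/-- The gap between agony and `|F|` is the total slack on `F`. -/
theorem exists_slack_pos [Fintype V] {E F : Finset (V × V)} {r : V → ℤ} {Q : ℕ}
    (h : Stable E F r Q) (hlt : (F.card : ℤ) < agony E r) : ∃ e ∈ F, 0 < slack r e := by
  rw [h.conforms.agony_eq h.eulerian h.subset] at hlt
  exact Finset.exists_lt_of_sum_lt (f := fun _ => (0 : ℤ)) (by simpa using hlt)

theorem Stable.succ_pred {E F : Finset (V × V)} {r : V → ℤ} {Q : ℕ}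
    (h : Stable E F r Q) (he : ∃ e ∈ F, 0 < slack r e) : ∃ Q', Q = Q' + 1 := by
  obtain ⟨e, heF, hpos⟩ := he
  have hm : e ∈ F.filter (fun e => 0 < slack r e) := Finset.mem_filter.2 ⟨heF, hpos⟩
  have := Finset.card_pos.2 ⟨e, hm⟩
  have := h.card_le
  exact ⟨Q - 1, by omega⟩

theorem Good.step [Fintype V] {E : Finset (V × V)} {k : ℕ} {a b : Ctrl V × Mem V}
    (hg : Good E k a) (hs : Step E a b) : 0 < k ∧ Good E (k - 1) b := by
  cases hs with
  | test_edge μ pend a c e he =>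
    obtain ⟨Q, h1, h2, h3, h4⟩ := hg
    have hc := Finset.card_erase_add_one he
    -- The budget inequality has `k + E.card` on its right, so this is what makes `k` positive.
    have hT : E.card + 1 ≤ testCost E Q := by
      unfold testCost
      omega
    refine ⟨by omega, Q, h1, ?_, ?_, by omega⟩
    · rw [← h2, ← Finset.add_sum_erase _ _ he, add_assoc]
    · rw [← h3, ← Finset.add_sum_erase _ _ he, add_assoc]
  | test_stop μ a c h =>
    obtain ⟨Q, h1, h2, h3, h4⟩ := hg
    have hT : E.card + 1 ≤ testCost E Q := by
      unfold testCost
      omega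
    rw [Finset.sum_empty] at h2 h3
    exact ⟨by omega, Q, h1, by omega⟩
  | test_continue μ a c h =>
    obtain ⟨Q, h1, h2, h3, h4⟩ := hg
    rw [Finset.sum_empty] at h2 h3
    have hpos := exists_slack_pos h1 (by omega)
    obtain ⟨Q, rfl⟩ := h1.succ_pred hpos
    rw [testCost_succ] at h4
    exact ⟨by omega, Q, h1, hpos, by simp,
      fun e he hE => absurd (h1.subset he) hE, by omega⟩
  | select_take μ pend best e he hF h =>
    obtain ⟨Q, h1, h2, h3, h4, h5⟩ := hg
    have hc := Finset.card_erase_add_one he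
    refine ⟨by omega, Q, h1, h2, by simpa using hF, fun e' he' hp => ⟨e, rfl, ?_⟩, by omega⟩
    by_cases hee : e' = e
    · rw [hee]
    · obtain ⟨b, hb, hle⟩ := h4 e' he' fun hp' => hp (Finset.mem_erase.2 ⟨hee, hp'⟩)
      exact hle.trans (h b hb)
  | select_skip μ pend best e he h =>
    obtain ⟨Q, h1, h2, h3, h4, h5⟩ := hg
    have hc := Finset.card_erase_add_one he
    refine ⟨by omega, Q, h1, h2, h3, fun e' he' hp => ?_, by omega⟩
    by_cases hee : e' = e
    · rw [hee] at he' ⊢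
      exact h.resolve_left (not_not.2 he')
    · exact h4 e' he' fun hp' => hp (Finset.mem_erase.2 ⟨hee, hp'⟩)
  | select_end μ p s =>
    obtain ⟨Q, h1, ⟨e, he, hpos⟩, h3, h4, h5⟩ := hg
    obtain ⟨b, hb, hle⟩ := h4 e he (Finset.notMem_empty e)
    obtain rfl : (p, s) = b := by simpa using hb
    exact ⟨by omega, Q, h1, h3 _ rfl, hpos.trans_le hle, by simp [endpoints], by
      rw [Finset.card_empty] at h5
      omega⟩
  | save_edge μ p s pend e he =>
    obtain ⟨Q, h1, h2, h3, h4, h5⟩ := hg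
    have hc := Finset.card_erase_add_one he
    refine ⟨by omega, Q, h1, h2, h3, fun v hv => ?_, by omega⟩
    simp only [Mem.saveEdge]
    by_cases hv2 : v = e.2
    · subst hv2
      simp
    by_cases hv1 : v = e.1
    · subst hv1
      simp [Function.update_of_ne hv2]
    simp only [Function.update_of_ne hv2, Function.update_of_ne hv1]
    refine h4 v ?_
    simp only [endpoints, Finset.mem_union, Finset.mem_image, Finset.mem_sdiff,
      Finset.mem_erase, not_and] at hv ⊢
    rcases hv with ⟨e', ⟨h6, h7⟩, rfl⟩ | ⟨e', ⟨h6, h7⟩, rfl⟩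
    · exact Or.inl ⟨e', ⟨h6, h7 fun hee => hv1 (hee ▸ rfl)⟩, rfl⟩
    · exact Or.inr ⟨e', ⟨h6, h7 fun hee => hv2 (hee ▸ rfl)⟩, rfl⟩
  | save_end μ p s =>
    obtain ⟨Q, h1, h2, h3, h4, h5⟩ := hg
    rw [Finset.sdiff_empty] at h4
    have hle := h1.slack_le _ h2
    have hM : (μ.rk s - μ.rk p - 1).toNat ≤ E.card := by
      unfold slack at hle
      simp only at hle
      omega
    exact ⟨by omega, Q, h1, h2, h3, h4, by omega⟩
  | create_list μ p s n =>
    obtain ⟨Q, h1, h2, h3, h4, h5⟩ := hg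
    exact ⟨by omega, Q, h1, h2, h3, h4, by omega⟩
  | create_end μ p s =>
    obtain ⟨Q, h1, h2, h3, h4, h5⟩ := hg
    have hle := h1.slack_le _ h2
    have hM : (μ.rk s - μ.rk p - 1).toNat ≤ E.card := by
      unfold slack at hle
      simp only at hle
      omega
    have hv := sum_visitCost_le E
    refine ⟨by omega, Q, ∅, fun _ => 0,
      Core.init h1 h2 h3 (fun v hv => (h4 v hv).1) (fun v hv => (h4 v hv).2), ?_⟩
    rw [Finset.sdiff_empty]
    change _ + (μ.rk s - μ.rk p - 1).toNat + _ ≤ _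
    omega
  | loop_end μ p s h =>
    obtain ⟨Q, D, idx, h1, h2⟩ := hg
    exact ⟨by omega, Q, D, idx, h1.relieved h, by omega⟩
  | loop_lower μ p s hS h =>
    obtain ⟨Q, D, idx, h1, h2⟩ := hg
    obtain ⟨h3, h4⟩ := h1.lower hS h
    refine ⟨by omega, Q, D, idx, h4, ?_⟩
    change _ + (μ.top - 1).toNat + _ ≤ _
    omega
  | loop_pop μ p s u hu h =>
    obtain ⟨Q, D, idx, h1, h2⟩ := hg
    have huD : u ∈ endpoints E \ D := Finset.mem_sdiff.2 ⟨h1.queue_sub hu, h1.disj u hu⟩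
    -- The share of `u` leaves the sum over unvisited vertices and pays for its visit.
    have hsum := Finset.add_sum_erase _ (visitCost E) huD
    rw [← Finset.sdiff_insert] at hsum
    unfold visitCost at hsum h2
    refine ⟨by omega, Q, _, _, h1.pop hu h, ?_⟩
    change _ + μ.top.toNat + _ + _ + _ + 2 ≤ _
    unfold visitCost
    omega
  | outgoing_edge μ p s u pend e he =>
    obtain ⟨Q, D, idx, h1, h2⟩ := hg
    have hc := Finset.card_erase_add_one he
    obtain ⟨h3, h4⟩ := h1.relaxOut he
    refine ⟨by omega, Q, D, idx, h4, ?_⟩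
    rw [h3]
    omega
  | outgoing_end μ p s u =>
    obtain ⟨Q, D, idx, h1, h2⟩ := hg
    exact ⟨by omega, Q, D, idx, h1, by omega⟩
  | incoming_edge μ p s u pend e he =>
    obtain ⟨Q, D, idx, h1, h2⟩ := hg
    have hc := Finset.card_erase_add_one he
    obtain ⟨h3, h4⟩ := h1.relaxIn he
    refine ⟨by omega, Q, D, idx, h4, ?_⟩
    rw [h3]
    omega
  | incoming_end μ p s u =>
    obtain ⟨Q, D, idx, h1, h2⟩ := hg
    exact ⟨by omega, Q, D, idx, h1, by omega⟩
  | check_zero μ p s h =>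
    obtain ⟨Q, D, idx, h1, h2⟩ := hg
    exact ⟨by omega, (h1.stable_of_slack_zero h).good_test (by omega)⟩
  | check_pos μ p s h =>
    obtain ⟨Q, D, idx, h1, h2⟩ := hg
    have := h1.idx_bound s (h1.target h)
    exact ⟨by omega, Q, μ.F, D, idx, h1, h, Tracing.start h1 h, by omega⟩
  | trace_edge μ p s v h =>
    obtain ⟨Q, F, D, idx, h1, h2, h3, h4⟩ := hg
    have := h1.idx_lt v h3.at_mem h
    exact ⟨by omega, Q, F, D, idx, h1, h2, h3.step h1 h, by omega⟩
  | trace_end μ p s =>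
    obtain ⟨Q, F, D, idx, h1, h2, h3, h4⟩ := hg
    exact ⟨by omega, (h3.stable h1 h2).good_test (by omega)⟩

theorem Good.steps [Fintype V] {E : Finset (V × V)} {k n : ℕ} {a b : Ctrl V × Mem V}
    (hg : Good E k a) (hs : Steps E n a b) : n ≤ k ∧ Good E (k - n) b := by
  induction hs with
  | zero a => exact ⟨Nat.zero_le _, hg⟩
  | succ _ hs ih =>
    obtain ⟨h1, h2⟩ := ih hg
    obtain ⟨h3, h4⟩ := h2.step hs
    exact ⟨by omega, by rwa [Nat.sub_sub] at h4⟩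

/-- The only possible deadlock is a selection that ends without a candidate; the invariant excludes
it, since an edge of positive slack exists. -/
theorem Good.eq_done {E : Finset (V × V)} {k : ℕ} {b : Ctrl V × Mem V} (hg : Good E k b)
    (hb : ¬ ∃ c, Step E b c) : b.1 = .done := by
  obtain ⟨ctrl, μ⟩ := b
  by_contra hne
  apply hb
  cases ctrl with
  | test pend a c =>
    obtain rfl | ⟨e, he⟩ := pend.eq_empty_or_nonempty
    · rcases le_or_gt a c with h | h
      · exact ⟨_, Step.test_stop μ a c h⟩
      · exact ⟨_, .test_continue μ a c h⟩
    · exact ⟨_, .test_edge μ pend a c e he⟩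
  | select pend best =>
    obtain rfl | ⟨e, he⟩ := pend.eq_empty_or_nonempty
    · obtain ⟨Q, -, ⟨e, he, -⟩, -, h4, -⟩ := hg
      obtain ⟨⟨p, s⟩, hb, -⟩ := h4 e he (Finset.notMem_empty e)
      obtain rfl : best = some (p, s) := hb
      exact ⟨_, .select_end μ p s⟩
    · by_cases h : e ∉ μ.F ∨ ∃ b ∈ best, slack μ.rk e ≤ slack μ.rk b
      · exact ⟨_, .select_skip μ pend best e he h⟩
      · push Not at h
        exact ⟨_, .select_take μ pend best e he h.1 fun b hb => (h.2 b hb).le⟩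
  | save p s pend =>
    obtain rfl | ⟨e, he⟩ := pend.eq_empty_or_nonempty
    · exact ⟨_, .save_end μ p s⟩
    · exact ⟨_, .save_edge μ p s pend e he⟩
  | create p s n =>
    cases n with
    | zero => exact ⟨_, .create_end μ p s⟩
    | succ n => exact ⟨_, .create_list μ p s n⟩
  | loop p s =>
    obtain h | h := μ.S.eq_empty_or_nonempty
    · exact ⟨_, .loop_end μ p s h⟩
    · by_cases hu : ∃ u ∈ μ.S, μ.t u = μ.top
      · obtain ⟨u, hu, ht⟩ := hu
        exact ⟨_, .loop_pop μ p s u hu ht⟩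
      · exact ⟨_, .loop_lower μ p s h fun v hv ht => hu ⟨v, hv, ht⟩⟩
  | outgoing p s u pend =>
    obtain rfl | ⟨e, he⟩ := pend.eq_empty_or_nonempty
    · exact ⟨_, .outgoing_end μ p s u⟩
    · exact ⟨_, .outgoing_edge μ p s u pend e he⟩
  | incoming p s u pend =>
    obtain rfl | ⟨e, he⟩ := pend.eq_empty_or_nonempty
    · exact ⟨_, .incoming_end μ p s u⟩
    · exact ⟨_, .incoming_edge μ p s u pend e he⟩
  | check p s =>
    rcases le_or_gt (slack μ.rk (p, s)) 0 with h | h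
    · exact ⟨_, .check_zero μ p s h⟩
    · exact ⟨_, .check_pos μ p s h⟩
  | trace p s v =>
    by_cases h : v = p
    · subst h
      exact ⟨_, .trace_end μ v s⟩
    · exact ⟨_, .trace_edge μ p s v h⟩
  | done => exact absurd rfl hne

end Execution

end Agony

/-! ### The main theorem. -/

theorem mainTheorem1 :
    ∃ C : ℕ, ∀ (V : Type*) [Fintype V] [DecidableEq V]
      (E H : Finset (V × V)) (r : V → ℤ),
      Agony.IsMaximalEulerian E H → Agony.Conforms E H r →
      (∀ e ∈ H, Agony.slack r e ≤ (E.card : ℤ)) →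
      ∀ a : Agony.Ctrl V × Agony.Mem V, Agony.IsStart E H r a →
        -- every execution has `O(m ^ 2)` steps
        (∀ (n : ℕ) (b : Agony.Ctrl V × Agony.Mem V), Agony.Steps E n a b →
          n ≤ C * (E.card ^ 2 + 1)) ∧
        -- where an execution cannot go on, the algorithm has stopped with an optimal result
        (∀ (n : ℕ) (b : Agony.Ctrl V × Agony.Mem V), Agony.Steps E n a b →
          (¬ ∃ c : Agony.Ctrl V × Agony.Mem V, Agony.Step E b c) →
            b.1 = Agony.Ctrl.done ∧
            Agony.IsMaximalEulerian E b.2.F ∧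
            Agony.Conforms E b.2.F b.2.rk ∧
            Agony.agony E b.2.rk = (b.2.F.card : ℤ) ∧
            (∀ r' : V → ℤ, Agony.agony E b.2.rk ≤ Agony.agony E r') ∧
            Agony.IsMaximumEulerian E b.2.F) := by
  refine ⟨22, fun V _ _ E H r hH hr hs a ha => ?_⟩
  obtain ⟨ctrl, μ⟩ := a
  obtain ⟨h1, h2, h3⟩ := ha
  simp only at h1 h2 h3
  subst h1 h2 h3
  -- At the start every edge of the subgraph may have positive slack, so `Q = m`.
  have hst : Agony.Stable E μ.F μ.rk E.card := ⟨hH.prop.1, hH.prop.2, hr, hs,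
    (Finset.card_filter_le _ _).trans (Finset.card_le_card hH.prop.1)⟩
  have hg := hst.good_test le_rfl
  refine ⟨fun n b hb => (hg.steps hb).1.trans ?_, fun n b hb hfinal => ?_⟩
  -- The budget is `15 m ^ 2 + 7 m + 1`, and `m ≤ m ^ 2`; hence `15 + 7 = 22`.
  · unfold Agony.testCost
    nlinarith
  · have hgb := (hg.steps hb).2
    have hdone := hgb.eq_done hfinal
    obtain ⟨ctrl, ν⟩ := b
    obtain rfl : ctrl = .done := hdone
    obtain ⟨Q, h, hle⟩ := hgb
    have hag : Agony.agony E ν.rk = ν.F.card :=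
      le_antisymm hle (h.eulerian.card_le_agony h.subset _)
    refine ⟨rfl, h.conforms.isMaximalEulerian h.eulerian h.subset, h.conforms, hag,
      fun r' => hag.trans_le (h.eulerian.card_le_agony h.subset r'), h.subset, h.eulerian,
      fun F' hF' he => ?_⟩
    have := he.card_le_agony hF' ν.rk
    simp only at *
    omega
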